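/- Let $\mathbb{H}$ be the real algebra of quaternions, let $\mathbb{S}=\{q\in\mathbb{H} : q^2=-1\}$ and, for $I\in\mathbb{S}$, let $L_I=\mathbb{R}+I\mathbb{R}$, which is identified with $\mathbb{C}$. A domain is a nonempty connected open set. A domain $\Omega\subseteq\mathbb{H}$ is called a slice domain if it intersects the real axis and $\Omega_I=\Omega\cap L_I$ is a domain in $L_I$ for every $I\in\mathbb{S}$; it is called symmetric if, for all $x,y\in\mathbb{R}$ and $I\in\mathbb{S}$ with $x+yI\in\Omega$, we have $x+yJ\in\Omega$ for all $J\in\mathbb{S}$. A function $f:\Omega\to\mathbb{H}$ is called regular if, for every $I\in\mathbb{S}$, the restriction $f_I=f|_{\Omega_I}$ is of class $C^1$ and $$\frac12\left(\frac{\partial}{\partial x}+I\frac{\partial}{\partial y}\right)f_I(x+yI)=0\quad\text{for all } x+yI\in\Omega_I.$$ **Theorem (Minimum Modulus Principle).** Let $\Omega\subseteq\mathbb{H}$ be a symmetric slice domain and let $f:\Omega\to\mathbb{H}$ be a regular function. If $|f|$ has a local minimum at a point $p\in\Omega$, then either $f(p)=0$ or $f$ is constant on $\Omega$. -/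

import Mathlib

namespace SliceRegular

/-- A domain: a (nonempty) connected open set. -/
def IsRegion {X : Type*} [TopologicalSpace X] (U : Set X) : Prop :=
  IsOpen U ∧ IsConnected U

/-- The sphere `𝕊` of quaternionic imaginary units. -/
def imaginaryUnits : Set (Quaternion ℝ) := {q | q ^ 2 = -1}

/-- For an imaginary unit `I`, the identification `x + i y ↦ x + y I` of `ℂ` with the complex
line `L_I = ℝ + I ℝ`. -/
noncomputable def sliceMap (I : Quaternion ℝ) (z : ℂ) : Quaternion ℝ :=
  (z.re : Quaternion ℝ) + (z.im : Quaternion ℝ) * I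

/-- The slice `Ω_I = Ω ∩ L_I`, read in `ℂ` through `sliceMap I`. -/
def slice (Ω : Set (Quaternion ℝ)) (I : Quaternion ℝ) : Set ℂ :=
  {z | sliceMap I z ∈ Ω}

/-- The restriction `f_I` of `f` to `L_I`, read in `ℂ` through `sliceMap I`. -/
noncomputable def sliceRestrict (f : Quaternion ℝ → Quaternion ℝ) (I : Quaternion ℝ) (z : ℂ) :
    Quaternion ℝ :=
  f (sliceMap I z)

/-- The operator `(1/2) (∂/∂x + I ∂/∂y)` applied to `f_I`, at the point `x + y I`,
where `z = x + i y`. -/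
noncomputable def dbar (I : Quaternion ℝ) (f : Quaternion ℝ → Quaternion ℝ) (z : ℂ) :
    Quaternion ℝ :=
  (1 / 2 : ℝ) • (fderiv ℝ (sliceRestrict f I) z 1
    + I * fderiv ℝ (sliceRestrict f I) z Complex.I)

/-- `f` is (slice) regular on the open set `Ω`: for each imaginary unit `I`, the restriction `f_I`
is of class `C¹` on `Ω_I` and is annihilated there by `(1/2) (∂/∂x + I ∂/∂y)`. Only the values of
`f` on `Ω` matter. -/
def IsRegularOn (f : Quaternion ℝ → Quaternion ℝ) (Ω : Set (Quaternion ℝ)) : Prop :=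
  ∀ I ∈ imaginaryUnits,
    ContDiffOn ℝ 1 (sliceRestrict f I) (slice Ω I) ∧ ∀ z ∈ slice Ω I, dbar I f z = 0

/-- A slice domain: a domain of `ℍ` that meets the real axis and whose slices `Ω_I` are all
domains of `L_I ≃ ℂ`. -/
structure IsSliceDomain (Ω : Set (Quaternion ℝ)) : Prop where
  isRegion : IsRegion Ω
  meets_real : ∃ x : ℝ, (x : Quaternion ℝ) ∈ Ω
  slice_isRegion : ∀ I ∈ imaginaryUnits, IsRegion (slice Ω I)

/-- Axial symmetry: if `x + y I ∈ C` then the whole of `x + y 𝕊` is contained in `C`. -/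
def IsAxiallySymmetric (C : Set (Quaternion ℝ)) : Prop :=
  ∀ x y : ℝ, ∀ I ∈ imaginaryUnits, (x : Quaternion ℝ) + (y : Quaternion ℝ) * I ∈ C →
    ∀ J ∈ imaginaryUnits, (x : Quaternion ℝ) + (y : Quaternion ℝ) * J ∈ C

end SliceRegular

open Quaternion Filter Topology

namespace SliceRegular

/-! Write `p = x₀ + y₀ I`, `a = f p ≠ 0`. On symmetric slice domains `f (x + y J) = b z + J * c z`,
where `(b, c)` depends only on `z = x + i y` and satisfies the Cauchy-Riemann equations. Put `A_z w
= w * b z + I * (w * c z)`. This is linear for left multiplication by `I`, depends holomorphically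
on `z`, and equals `w * f (x + y w⁻¹ I w)` for `w ≠ 0`. Minimality thus says `‖A_z w‖ ≥ ‖w‖ ‖a‖`
near `(z₀, 1)`, with equality at `(z₀, 1)` because `A_{z₀} 1 = a`.

This bound makes `A_{z₀}` injective, so `g z = A_z⁻¹ a` is holomorphic near `z₀`, with `g z₀ = 1`
and `‖g‖ ≤ 1`. The maximum principle gives `g = 1`, that is, `f = a` near `p` on `L_I`; the identity
principle and the representation formula spread this to `Ω`. -/

theorem mul_self_of_mem_imaginaryUnits {J : ℍ[ℝ]} (hJ : J ∈ imaginaryUnits) : J * J = -1 := by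
  rw [← sq]
  exact hJ

theorem star_eq_neg_of_mem_imaginaryUnits {J : ℍ[ℝ]} (hJ : J ∈ imaginaryUnits) : star J = -J := by
  have h := mul_self_of_mem_imaginaryUnits hJ
  have hJ0 : J ≠ 0 := by rintro rfl; simp at h
  have hn : ‖J‖ * ‖J‖ = 1 := by rw [← norm_mul, h, norm_neg, norm_one]
  have hs : J * star J = 1 := by
    rw [Quaternion.self_mul_star, Quaternion.normSq_eq_norm_mul_self, hn, Quaternion.coe_one]
  have : J * (star J + J) = 0 := by rw [mul_add, hs, h, add_neg_cancel]
  exact eq_neg_of_add_eq_zero_left ((mul_eq_zero.1 this).resolve_left hJ0)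

theorem norm_sliceMap {J : ℍ[ℝ]} (hJ : J ∈ imaginaryUnits) (z : ℂ) : ‖sliceMap J z‖ = ‖z‖ := by
  have h := mul_self_of_mem_imaginaryUnits hJ
  have h1 : ((normSq (sliceMap J z) : ℝ) : ℍ[ℝ]) = ((z.re ^ 2 + z.im ^ 2 : ℝ) : ℍ[ℝ]) := by
    rw [← Quaternion.self_mul_star]
    simp only [sliceMap, star_add, star_mul, Quaternion.star_coe,
      star_eq_neg_of_mem_imaginaryUnits hJ]
    have hc : (z.im : ℍ[ℝ]) * J = J * (z.im : ℍ[ℝ]) := Quaternion.coe_commutes _ _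
    have hc2 : (z.re : ℍ[ℝ]) * J = J * (z.re : ℍ[ℝ]) := Quaternion.coe_commutes _ _
    have hc3 : (z.im : ℍ[ℝ]) * z.re = z.re * z.im := Quaternion.coe_commutes _ _
    have : ((z.re : ℍ[ℝ]) + z.im * J) * (z.re + -J * z.im)
        = z.re * z.re - (z.re * J) * z.im + z.im * J * z.re - z.im * (J * J) * z.im := by
      noncomm_ring
    rw [this, h, hc, hc2, mul_assoc J, mul_assoc J, hc3]
    push_cast
    noncomm_ring
  have h2 := Quaternion.coe_injective h1
  rw [Quaternion.normSq_eq_norm_mul_self] at h2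
  have h3 : ‖z‖ * ‖z‖ = z.re ^ 2 + z.im ^ 2 := by
    rw [← sq, Complex.sq_norm, Complex.normSq_apply]; ring
  exact (mul_self_inj (norm_nonneg _) (norm_nonneg _)).1 (h2.trans h3.symm)

/-- The complex normed space structure on `ℍ` in which `i` acts as left multiplication by the
imaginary unit `J`. -/
noncomputable abbrev leftComplexStructure {J : ℍ[ℝ]} (hJ : J ∈ imaginaryUnits) :
    NormedSpace ℂ ℍ[ℝ] where
  toModule := Module.compHom ℍ[ℝ]
    (Complex.liftAux J (mul_self_of_mem_imaginaryUnits hJ)).toRingHom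
  norm_smul_le z q := by
    change ‖Complex.liftAux J (mul_self_of_mem_imaginaryUnits hJ) z * q‖ ≤ _
    rw [norm_mul, ← norm_sliceMap hJ z, Complex.liftAux_apply]
    simp [sliceMap, Quaternion.coe_mul_eq_smul]

theorem leftComplexStructure_smul {J : ℍ[ℝ]} (hJ : J ∈ imaginaryUnits) (z : ℂ) (q : ℍ[ℝ]) :
    letI := leftComplexStructure hJ
    z • q = z.re • q + z.im • (J * q) := by
  change Complex.liftAux J (mul_self_of_mem_imaginaryUnits hJ) z * q = _
  rw [Complex.liftAux_apply, add_mul, smul_mul_assoc]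
  congr 1
  exact Quaternion.coe_mul_eq_smul _ _

theorem leftComplexStructure_isScalarTower {J : ℍ[ℝ]} (hJ : J ∈ imaginaryUnits) :
    letI := leftComplexStructure hJ
    IsScalarTower ℝ ℂ ℍ[ℝ] := by
  let := leftComplexStructure hJ
  refine ⟨fun r z q => ?_⟩
  rw [leftComplexStructure_smul, leftComplexStructure_smul, Complex.smul_re, Complex.smul_im,
    smul_add, smul_eq_mul, smul_eq_mul, mul_smul, mul_smul]

/-! ### Holomorphy for left multiplication by an imaginary unit -/

/-- A real differentiable function `g` near `z` satisfying the Cauchy-Riemann equation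
`∂g/∂y = J ∂g/∂x` for left multiplication by `J`. -/
def LeftHolomorphicAt (J : ℍ[ℝ]) (g : ℂ → ℍ[ℝ]) (z : ℂ) : Prop :=
  ∃ g' : ℂ →L[ℝ] ℍ[ℝ], HasFDerivAt g g' z ∧ g' Complex.I = J * g' 1

theorem LeftHolomorphicAt.differentiableAt {J : ℍ[ℝ]} (hJ : J ∈ imaginaryUnits) {g : ℂ → ℍ[ℝ]}
    {z : ℂ} (h : LeftHolomorphicAt J g z) :
    letI := leftComplexStructure hJ
    DifferentiableAt ℂ g z := by
  let := leftComplexStructure hJ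
  have := leftComplexStructure_isScalarTower hJ
  obtain ⟨g', hg, hI⟩ := h
  refine (hasFDerivAt_of_restrictScalars (𝕜 := ℝ) (𝕜' := ℂ)
    (f' := (1 : ℂ →L[ℂ] ℂ).smulRight (g' 1)) hg ?_).differentiableAt
  ext1 w
  change w • g' 1 = g' w
  rw [leftComplexStructure_smul, ← hI]
  conv_rhs => rw [show w = w.re • (1 : ℂ) + w.im • Complex.I by
    simp [Complex.re_add_im]]
  rw [map_add, map_smul, map_smul]

theorem LeftHolomorphicAt.eqOn {J : ℍ[ℝ]} (hJ : J ∈ imaginaryUnits) {g h : ℂ → ℍ[ℝ]} {U : Set ℂ}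
    (hU : IsOpen U) (hc : IsPreconnected U) (hg : ∀ z ∈ U, LeftHolomorphicAt J g z)
    (hh : ∀ z ∈ U, LeftHolomorphicAt J h z) {z₀ : ℂ} (hz₀ : z₀ ∈ U)
    (heq : ∃ᶠ z in 𝓝[≠] z₀, g z = h z) : Set.EqOn g h U := by
  let := leftComplexStructure hJ
  have key : ∀ k : ℂ → ℍ[ℝ], (∀ z ∈ U, LeftHolomorphicAt J k z) → AnalyticOnNhd ℂ k U :=
    fun k hk => DifferentiableOn.analyticOnNhd
      (fun z hz => ((hk z hz).differentiableAt hJ).differentiableWithinAt) hU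
  exact (key g hg).eqOn_of_preconnected_of_frequently_eq (key h hh) hc hz₀ heq

theorem LeftHolomorphicAt.eventually_eq_of_isLocalMax_norm {J : ℍ[ℝ]} (hJ : J ∈ imaginaryUnits)
    {g : ℂ → ℍ[ℝ]} {z₀ : ℂ} (hg : ∀ᶠ z in 𝓝 z₀, LeftHolomorphicAt J g z)
    (hmax : IsLocalMax (fun z => ‖g z‖) z₀) : ∀ᶠ z in 𝓝 z₀, g z = g z₀ := by
  -- Strict convexity comes from the Euclidean structure. Stated through norms alone, it carries
  -- over to the real structure underlying the complex one; it upgrades constancy of `‖g‖` to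
  -- constancy of `g`.
  have hne : ∀ ⦃x y : ℍ[ℝ]⦄, ‖x‖ = 1 → ‖y‖ = 1 → x ≠ y → ‖x + y‖ ≠ 2 := fun x y hx hy hxy h =>
    hxy (eq_of_norm_eq_of_norm_add_eq (hx.trans hy.symm) (by rw [h, hx, hy]; norm_num))
  let := leftComplexStructure hJ
  let : NormedSpace ℝ ℍ[ℝ] := NormedSpace.complexToReal
  have : StrictConvexSpace ℝ ℍ[ℝ] := StrictConvexSpace.of_norm_add_ne_two hne
  exact Complex.eventually_eq_of_isLocalMax_norm (hg.mono fun z hz => hz.differentiableAt hJ) hmax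

/-! ### Stem functions -/

/-- The pair `(b, c)` satisfies at `z` the Cauchy-Riemann equations of a stem function `b + i c`. -/
def IsStemAt (b c : ℂ → ℍ[ℝ]) (z : ℂ) : Prop :=
  ∃ b' c' : ℂ →L[ℝ] ℍ[ℝ], HasFDerivAt b b' z ∧ HasFDerivAt c c' z ∧
    b' Complex.I = -c' 1 ∧ c' Complex.I = b' 1

theorem IsStemAt.leftHolomorphicAt {J : ℍ[ℝ]} (hJ : J ∈ imaginaryUnits) {b c : ℂ → ℍ[ℝ]} {z : ℂ}
    (h : IsStemAt b c z) : LeftHolomorphicAt J (fun z => b z + J * c z) z := by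
  obtain ⟨b', c', hb, hc, h1, h2⟩ := h
  refine ⟨_, hb.add (hc.const_mul J), ?_⟩
  simp only [add_apply, smul_apply, smul_eq_mul, h1, h2,
    mul_add, ← mul_assoc, mul_self_of_mem_imaginaryUnits hJ]
  noncomm_ring

/-- The real part of the stem function induced by a function on the slice `L_J`. -/
noncomputable def stemRe (F : ℂ → ℍ[ℝ]) (z : ℂ) : ℍ[ℝ] :=
  (1 / 2 : ℝ) • (F z + F (star z))

/-- The imaginary part of the stem function induced by a function on the slice `L_J`. -/
noncomputable def stemIm (J : ℍ[ℝ]) (F : ℂ → ℍ[ℝ]) (z : ℂ) : ℍ[ℝ] :=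
  (1 / 2 : ℝ) • (J * (F (star z) - F z))

theorem stemRe_add_mul_stemIm {J : ℍ[ℝ]} (hJ : J ∈ imaginaryUnits) (F : ℂ → ℍ[ℝ]) (z : ℂ) :
    stemRe F z + J * stemIm J F z = F z := by
  rw [stemRe, stemIm, mul_smul_comm, ← mul_assoc, mul_self_of_mem_imaginaryUnits hJ, ← smul_add,
    show F z + F (star z) + -1 * (F (star z) - F z) = (2 : ℝ) • F z by
      rw [two_smul]; noncomm_ring, smul_smul]
  norm_num

theorem isStemAt_stem {J : ℍ[ℝ]} (hJ : J ∈ imaginaryUnits) {F : ℂ → ℍ[ℝ]} {z : ℂ}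
    (h : LeftHolomorphicAt J F z) (h' : LeftHolomorphicAt J F (star z)) :
    IsStemAt (stemRe F) (stemIm J F) z := by
  obtain ⟨P, hP, hPI⟩ := h
  obtain ⟨Q, hQ, hQI⟩ := h'
  have hconj : HasFDerivAt (fun z : ℂ => star z) (Complex.conjCLE : ℂ →L[ℝ] ℂ) z :=
    Complex.conjCLE.hasFDerivAt
  have hQ' : HasFDerivAt (fun z => F (star z)) (Q.comp (Complex.conjCLE : ℂ →L[ℝ] ℂ)) z :=
    hQ.comp z hconj
  have hJJ := mul_self_of_mem_imaginaryUnits hJ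
  refine ⟨_, _, (hP.add hQ').const_smul (1 / 2 : ℝ),
    ((hQ'.sub hP).const_mul J).const_smul (1 / 2 : ℝ), ?_, ?_⟩
  · simp [hPI, hQI, ← smul_neg, -smul_add]
    noncomm_ring
  · simp [hPI, hQI, -smul_add, mul_sub, ← mul_assoc, hJJ]
    abel

/-! ### The operator attached to a stem function -/

/-- The operator `w ↦ w b + J w c`. -/
noncomputable def stemOp (J b c : ℍ[ℝ]) : ℍ[ℝ] →L[ℝ] ℍ[ℝ] :=
  (ContinuousLinearMap.mul ℝ ℍ[ℝ]).flip b +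
    (ContinuousLinearMap.mul ℝ ℍ[ℝ] J).comp ((ContinuousLinearMap.mul ℝ ℍ[ℝ]).flip c)

@[simp]
theorem stemOp_apply (J b c w : ℍ[ℝ]) : stemOp J b c w = w * b + J * (w * c) := rfl

theorem stemOp_mul_left {J : ℍ[ℝ]} (b c w : ℍ[ℝ]) :
    stemOp J b c (J * w) = J * stemOp J b c w := by
  simp [mul_add, mul_assoc]

/-- Conjugating `J` by `w` turns the operator into evaluation of `b + K * c` at another imaginary
unit `K`, so bounds on `f` off the slice become bounds on the operator. -/
theorem stemOp_eq (J b c w : ℍ[ℝ]) (hw : w ≠ 0) :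
    stemOp J b c w = w * (b + w⁻¹ * J * w * c) := by
  rw [stemOp_apply, mul_add, ← mul_assoc w, ← mul_assoc w, ← mul_assoc w, mul_inv_cancel₀ hw,
    one_mul, mul_assoc J]

theorem differentiable_stemOp (J : ℍ[ℝ]) {b c : ℂ → ℍ[ℝ]} {z : ℂ}
    (hb : DifferentiableAt ℝ b z) (hc : DifferentiableAt ℝ c z) :
    DifferentiableAt ℝ (fun z => stemOp J (b z) (c z)) z := by
  unfold stemOp
  fun_prop

/-- Invertibility is an open condition, so `g z = A_z⁻¹ a` is differentiable near `z₀`; its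
Cauchy-Riemann equation follows by differentiating `A_z (g z) = a`. -/
theorem exists_leftHolomorphicAt_stemOp_eq {J : ℍ[ℝ]} (hJ : J ∈ imaginaryUnits) {b c : ℂ → ℍ[ℝ]}
    {z₀ : ℂ} (h : ∀ᶠ z in 𝓝 z₀, IsStemAt b c z)
    (hinj : ∀ w, stemOp J (b z₀) (c z₀) w = 0 → w = 0) (a : ℍ[ℝ]) :
    ∃ g : ℂ → ℍ[ℝ], ContinuousAt g z₀ ∧ (∀ᶠ z in 𝓝 z₀, LeftHolomorphicAt J g z) ∧
      ∀ᶠ z in 𝓝 z₀, stemOp J (b z) (c z) (g z) = a := by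
  set A : ℂ → ℍ[ℝ] →L[ℝ] ℍ[ℝ] := fun z => stemOp J (b z) (c z) with hA
  have hAd : ∀ z, IsStemAt b c z → DifferentiableAt ℝ A z := fun z ⟨b', c', hb, hc, _⟩ =>
    differentiable_stemOp J hb.differentiableAt hc.differentiableAt
  have hker : (A z₀ : ℍ[ℝ] →ₗ[ℝ] ℍ[ℝ]).ker = ⊥ := LinearMap.ker_eq_bot'.2 hinj
  let e : ℍ[ℝ] ≃L[ℝ] ℍ[ℝ] := (LinearEquiv.ofInjectiveEndo (A z₀ : ℍ[ℝ] →ₗ[ℝ] ℍ[ℝ])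
    (LinearMap.ker_eq_bot.1 hker)).toContinuousLinearEquiv
  have he : (e : ℍ[ℝ] →L[ℝ] ℍ[ℝ]) = A z₀ := by ext1 w; rfl
  have hev : ∀ᶠ z in 𝓝 z₀, ∃ e : ℍ[ℝ] ≃L[ℝ] ℍ[ℝ], (e : ℍ[ℝ] →L[ℝ] ℍ[ℝ]) = A z := by
    have := e.nhds
    rw [he] at this
    exact (hAd z₀ h.self_of_nhds).continuousAt this
  have hg : ∀ z, IsStemAt b c z → (∃ e : ℍ[ℝ] ≃L[ℝ] ℍ[ℝ], (e : ℍ[ℝ] →L[ℝ] ℍ[ℝ]) = A z) →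
      DifferentiableAt ℝ (fun z => (A z).inverse a) z := by
    rintro z hz ⟨e, he⟩
    have h1 : DifferentiableAt ℝ
        (ContinuousLinearMap.inverse : (ℍ[ℝ] →L[ℝ] ℍ[ℝ]) → ℍ[ℝ] →L[ℝ] ℍ[ℝ]) (A z) := by
      rw [← he]
      exact (contDiffAt_map_inverse (n := 1) e).differentiableAt one_ne_zero
    have h2 : DifferentiableAt ℝ (fun z => (A z).inverse) z :=
      DifferentiableAt.comp (𝕜 := ℝ) (E := ℂ) (F := ℍ[ℝ] →L[ℝ] ℍ[ℝ]) (G := ℍ[ℝ] →L[ℝ] ℍ[ℝ]) z h1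
        (hAd z hz)
    exact h2.clm_apply (differentiableAt_const a)
  have hga : ∀ᶠ z in 𝓝 z₀, A z ((A z).inverse a) = a := by
    filter_upwards [hev] with z ⟨e, he⟩
    rw [← he, ContinuousLinearMap.inverse_equiv]
    exact e.apply_symm_apply a
  refine ⟨fun z => (A z).inverse a, (hg z₀ h.self_of_nhds hev.self_of_nhds).continuousAt, ?_, hga⟩
  filter_upwards [h, hev, hga.eventually_nhds] with z hz he hgz
  refine ⟨_, (hg z hz he).hasFDerivAt, ?_⟩
  set g' := fderiv ℝ (fun z => (A z).inverse a) z with hg'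
  obtain ⟨b', c', hb, hc, h1, h2⟩ := hz
  have hgd := (hg z ⟨b', c', hb, hc, h1, h2⟩ he).hasFDerivAt
  have hd := (hgd.mul' hb).add ((hgd.mul' hc).const_mul J)
  have h0 := hd.unique ((hasFDerivAt_const a z).congr_of_eventuallyEq hgz)
  obtain ⟨e, he⟩ := he
  -- By the stem equations, the terms in `b'` and `c'` agree in the `y`-derivative and in `J` times
  -- the `x`-derivative. Subtracting leaves `A (g' i) = J * A (g' 1) = A (J * g' 1)`.
  refine e.injective ?_
  change (e : ℍ[ℝ] →L[ℝ] ℍ[ℝ]) _ = (e : ℍ[ℝ] →L[ℝ] ℍ[ℝ]) _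
  rw [he]
  have hx := DFunLike.congr_fun h0 1
  have hy := DFunLike.congr_fun h0 Complex.I
  simp only [add_apply, smul_apply, smul_eq_mul, op_smul_eq_mul, zero_apply, h1, h2,
    ← hg'] at hx hy
  have hJx := congrArg (J * ·) hx
  simp only [mul_add, mul_zero, ← mul_assoc J J, mul_self_of_mem_imaginaryUnits hJ,
    neg_one_mul] at hJx hy
  change stemOp J (b z) (c z) (g' Complex.I) = stemOp J (b z) (c z) (J * g' 1)
  rw [stemOp_mul_left, stemOp_apply, stemOp_apply, mul_add, ← mul_assoc J J,
    mul_self_of_mem_imaginaryUnits hJ, neg_one_mul, ← sub_eq_zero, ← sub_eq_zero.2 (hy.trans hJx.symm)]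
  rw [mul_neg]
  abel

/-! ### Regular functions on symmetric slice domains -/

theorem IsRegularOn.leftHolomorphicAt {Ω : Set ℍ[ℝ]} {f : ℍ[ℝ] → ℍ[ℝ]} (hf : IsRegularOn f Ω)
    {J : ℍ[ℝ]} (hJ : J ∈ imaginaryUnits) (hU : IsOpen (slice Ω J)) {z : ℂ} (hz : z ∈ slice Ω J) :
    LeftHolomorphicAt J (sliceRestrict f J) z := by
  obtain ⟨hd, hbar⟩ := hf J hJ
  have h1 : DifferentiableAt ℝ (sliceRestrict f J) z :=
    ((hd.differentiableOn one_ne_zero) z hz).differentiableAt (hU.mem_nhds hz)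
  refine ⟨_, h1.hasFDerivAt, ?_⟩
  have h2 := hbar z hz
  rw [dbar, smul_eq_zero_iff_right (by norm_num)] at h2
  rw [eq_neg_of_add_eq_zero_left h2, mul_neg, ← mul_assoc, mul_self_of_mem_imaginaryUnits hJ,
    neg_one_mul, neg_neg]

theorem neg_mem_imaginaryUnits {J : ℍ[ℝ]} (hJ : J ∈ imaginaryUnits) : -J ∈ imaginaryUnits := by
  simpa [imaginaryUnits] using hJ

theorem inv_mul_mul_mem_imaginaryUnits {J w : ℍ[ℝ]} (hJ : J ∈ imaginaryUnits) (hw : w ≠ 0) :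
    w⁻¹ * J * w ∈ imaginaryUnits := by
  change (w⁻¹ * J * w) ^ 2 = -1
  have : (w⁻¹ * J * w) ^ 2 = w⁻¹ * J * (w * w⁻¹) * J * w := by noncomm_ring
  rw [this, mul_inv_cancel₀ hw, mul_one, mul_assoc w⁻¹, mul_self_of_mem_imaginaryUnits hJ,
    mul_neg_one, neg_mul, inv_mul_cancel₀ hw]

theorem IsAxiallySymmetric.slice_eq {Ω : Set ℍ[ℝ]} (hΩ : IsAxiallySymmetric Ω) {I J : ℍ[ℝ]}
    (hI : I ∈ imaginaryUnits) (hJ : J ∈ imaginaryUnits) : slice Ω I = slice Ω J :=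
  Set.ext fun z => ⟨fun h => hΩ z.re z.im I hI h J hJ, fun h => hΩ z.re z.im J hJ h I hI⟩

theorem sliceMap_star (J : ℍ[ℝ]) (z : ℂ) : sliceMap J (star z) = sliceMap (-J) z := by
  simp [sliceMap]

theorem IsAxiallySymmetric.star_mem_slice {Ω : Set ℍ[ℝ]} (hΩ : IsAxiallySymmetric Ω) {J : ℍ[ℝ]}
    (hJ : J ∈ imaginaryUnits) {z : ℂ} (hz : z ∈ slice Ω J) : star z ∈ slice Ω J := by
  rw [hΩ.slice_eq hJ (neg_mem_imaginaryUnits hJ)] at hz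
  change sliceMap J (star z) ∈ Ω
  rwa [sliceMap_star]

theorem exists_sliceMap_eq (q : ℍ[ℝ]) : ∃ J ∈ imaginaryUnits, ∃ z, sliceMap J z = q := by
  by_cases h : q.im = 0
  · refine ⟨Quaternion.ofComplex Complex.I, ?_, q.re, ?_⟩
    · change _ ^ 2 = _
      rw [← map_pow, Complex.I_sq, map_neg, map_one]
    · rw [sliceMap, Complex.ofReal_re, Complex.ofReal_im, Quaternion.coe_zero, zero_mul, ← h,
        Quaternion.re_add_im]
  · have hn : ‖q.im‖ ≠ 0 := norm_ne_zero_iff.2 h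
    refine ⟨‖q.im‖⁻¹ • q.im, ?_, ⟨q.re, ‖q.im‖⟩, ?_⟩
    · change _ ^ 2 = _
      rw [smul_pow, Quaternion.im_sq, Quaternion.normSq_eq_norm_mul_self, smul_neg,
        ← Quaternion.coe_smul]
      rw [smul_eq_mul, ← sq, inv_pow, inv_mul_cancel₀ (pow_ne_zero 2 hn), Quaternion.coe_one]
    · rw [sliceMap, Quaternion.coe_mul_eq_smul, smul_smul, mul_inv_cancel₀ hn, one_smul,
        Quaternion.re_add_im]

theorem frequently_nhdsNE_im_eq_zero (x : ℝ) : ∃ᶠ z : ℂ in 𝓝[≠] (x : ℂ), z.im = 0 := by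
  have h : Tendsto (fun t : ℝ => (t : ℂ)) (𝓝[≠] x) (𝓝[≠] (x : ℂ)) :=
    Complex.continuous_ofReal.continuousAt.continuousWithinAt.tendsto_nhdsWithin
      fun t ht => by simpa using ht
  exact h.frequently (Frequently.of_forall fun t => Complex.ofReal_im t)

/-- The representation formula: on a symmetric slice domain, a regular function is affine in the
imaginary unit. -/
theorem sliceRestrict_eq_stem {Ω : Set ℍ[ℝ]} (hΩ : IsSliceDomain Ω) (hsymm : IsAxiallySymmetric Ω)
    {f : ℍ[ℝ] → ℍ[ℝ]} (hf : IsRegularOn f Ω) {I J : ℍ[ℝ]} (hI : I ∈ imaginaryUnits)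
    (hJ : J ∈ imaginaryUnits) :
    Set.EqOn (sliceRestrict f J)
      (fun z => stemRe (sliceRestrict f I) z + J * stemIm I (sliceRestrict f I) z)
      (slice Ω J) := by
  have hIJ := hsymm.slice_eq hI hJ
  have hU := hΩ.slice_isRegion J hJ
  have hUI := hΩ.slice_isRegion I hI
  obtain ⟨x, hx⟩ := hΩ.meets_real
  -- Both sides are holomorphic for `J` and agree at real points, where `star z = z` kills the
  -- imaginary stem part.
  refine LeftHolomorphicAt.eqOn hJ hU.1 hU.2.isPreconnected
    (fun z hz => hf.leftHolomorphicAt hJ hU.1 hz) (fun z hz => ?_) (z₀ := (x : ℂ)) ?_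
    ((frequently_nhdsNE_im_eq_zero x).mono fun z hz => ?_)
  · rw [← hIJ] at hz
    exact (isStemAt_stem hI (hf.leftHolomorphicAt hI hUI.1 hz)
      (hf.leftHolomorphicAt hI hUI.1 (hsymm.star_mem_slice hI hz))).leftHolomorphicAt hJ
  · simpa [slice, sliceMap] using hx
  · have hz' : star z = z := Complex.conj_eq_iff_im.2 hz
    simp only [stemRe, stemIm, hz', sub_self, mul_zero, smul_zero, add_zero]
    rw [← two_smul ℝ, smul_smul]
    simp [sliceRestrict, sliceMap, hz]

theorem eq_const_of_eventually_sliceRestrict_eq {Ω : Set ℍ[ℝ]} (hΩ : IsSliceDomain Ω)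
    (hsymm : IsAxiallySymmetric Ω) {f : ℍ[ℝ] → ℍ[ℝ]} (hf : IsRegularOn f Ω) {I : ℍ[ℝ]}
    (hI : I ∈ imaginaryUnits) {z₀ : ℂ} (hz₀ : z₀ ∈ slice Ω I) {a : ℍ[ℝ]}
    (h : ∀ᶠ z in 𝓝 z₀, sliceRestrict f I z = a) : ∀ q ∈ Ω, f q = a := by
  have hU := hΩ.slice_isRegion I hI
  have hc : Set.EqOn (sliceRestrict f I) (fun _ => a) (slice Ω I) :=
    LeftHolomorphicAt.eqOn hI hU.1 hU.2.isPreconnected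
      (fun z hz => hf.leftHolomorphicAt hI hU.1 hz)
      (fun z _ => ⟨0, hasFDerivAt_const a z, by simp⟩) hz₀
      (h.filter_mono nhdsWithin_le_nhds).frequently
  intro q hq
  obtain ⟨J, hJ, z, rfl⟩ := exists_sliceMap_eq q
  have hz : z ∈ slice Ω I := hsymm.slice_eq hJ hI ▸ hq
  have h1 := sliceRestrict_eq_stem hΩ hsymm hf hI hJ hq
  simp only [stemRe, stemIm, hc hz, hc (hsymm.star_mem_slice hI hz)] at h1
  rw [← two_smul ℝ a, smul_smul] at h1
  simpa [sliceRestrict] using h1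

end SliceRegular

/-! ### The minimum modulus principle -/

open SliceRegular in
theorem mainTheorem4 (Ω : Set (Quaternion ℝ)) (hΩ : SliceRegular.IsSliceDomain Ω)
    (hsymm : SliceRegular.IsAxiallySymmetric Ω)
    (f : Quaternion ℝ → Quaternion ℝ) (hf : SliceRegular.IsRegularOn f Ω)
    (p : Quaternion ℝ) (hp : p ∈ Ω) (hmin : IsLocalMinOn (fun q => ‖f q‖) Ω p) :
    f p = 0 ∨ ∃ c : Quaternion ℝ, ∀ q ∈ Ω, f q = c := by
  refine or_iff_not_imp_left.2 fun hfp => ?_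
  obtain ⟨I, hI, z₀, rfl⟩ := exists_sliceMap_eq p
  have hz₀ : z₀ ∈ slice Ω I := hp
  have hU := hΩ.slice_isRegion I hI
  set F := sliceRestrict f I
  set b := stemRe F
  set c := stemIm I F
  set a := f (sliceMap I z₀)
  have hUn : ∀ᶠ z in 𝓝 z₀, z ∈ slice Ω I := hU.1.mem_nhds hz₀
  have hstem : ∀ᶠ z in 𝓝 z₀, IsStemAt b c z := by
    filter_upwards [hUn] with z hz
    exact isStemAt_stem hI (hf.leftHolomorphicAt hI hU.1 hz)
      (hf.leftHolomorphicAt hI hU.1 (hsymm.star_mem_slice hI hz))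
  have hop : ∀ z ∈ slice Ω I, ∀ w : ℍ[ℝ], w ≠ 0 →
      stemOp I (b z) (c z) w = w * f (sliceMap (w⁻¹ * I * w) z) := by
    intro z hz w hw
    have hJ := inv_mul_mul_mem_imaginaryUnits hI hw
    rw [stemOp_eq _ _ _ _ hw]
    exact congrArg (w * ·)
      (sliceRestrict_eq_stem hΩ hsymm hf hI hJ (hsymm.slice_eq hI hJ ▸ hz)).symm
  have hone : stemOp I (b z₀) (c z₀) 1 = a := by
    simpa using hop z₀ hz₀ 1 one_ne_zero
  have hbound : ∀ᶠ zw : ℂ × ℍ[ℝ] in 𝓝 (z₀, 1),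
      ‖stemOp I (b zw.1) (c zw.1) zw.2‖ ≥ ‖zw.2‖ * ‖a‖ := by
    have hcont : Tendsto (fun zw : ℂ × ℍ[ℝ] => sliceMap (zw.2⁻¹ * I * zw.2) zw.1) (𝓝 (z₀, 1))
        (𝓝 (sliceMap I z₀)) := by
      have : ContinuousAt (fun zw : ℂ × ℍ[ℝ] => sliceMap (zw.2⁻¹ * I * zw.2) zw.1) (z₀, 1) := by
        have h1 : ContinuousAt (fun zw : ℂ × ℍ[ℝ] => zw.2⁻¹) (z₀, 1) :=
          continuousAt_snd.inv₀ one_ne_zero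
        have hre : ContinuousAt (fun zw : ℂ × ℍ[ℝ] => (zw.1.re : ℍ[ℝ])) (z₀, 1) :=
          (Quaternion.continuous_coe.comp (Complex.continuous_re.comp continuous_fst)).continuousAt
        have him : ContinuousAt (fun zw : ℂ × ℍ[ℝ] => (zw.1.im : ℍ[ℝ])) (z₀, 1) :=
          (Quaternion.continuous_coe.comp (Complex.continuous_im.comp continuous_fst)).continuousAt
        exact hre.add (him.mul ((h1.mul continuousAt_const).mul continuousAt_snd))
      simpa [ContinuousAt] using this
    have hΩn : 𝓝[Ω] (sliceMap I z₀) = 𝓝 (sliceMap I z₀) := hΩ.isRegion.1.nhdsWithin_eq hp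
    rw [IsLocalMinOn, IsMinFilter, hΩn] at hmin
    filter_upwards [hcont.eventually hmin, continuousAt_fst.eventually hUn,
      continuousAt_snd.eventually_ne (one_ne_zero (α := ℍ[ℝ]))] with zw h1 h2 h3
    rw [hop zw.1 h2 zw.2 h3, norm_mul]
    gcongr
  have hinj : ∀ w, stemOp I (b z₀) (c z₀) w = 0 → w = 0 := by
    intro w hw
    have hlim : Tendsto (fun t : ℝ => ((z₀, 1 + t • w) : ℂ × ℍ[ℝ])) (𝓝 0) (𝓝 (z₀, 1)) := by
      have : Continuous (fun t : ℝ => ((z₀, 1 + t • w) : ℂ × ℍ[ℝ])) := by fun_prop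
      simpa using this.tendsto 0
    -- For `w` in the kernel, `A_{z₀} (1 + t w) = a`, so the bound forces `‖1 + t w‖ ≤ 1` for small
    -- `t` of either sign; the parallelogram law then gives `t w = 0`.
    have hle : ∀ᶠ t : ℝ in 𝓝 0, ‖1 + t • w‖ ≤ 1 := by
      filter_upwards [hlim.eventually hbound] with t ht
      rw [map_add, map_smul, hw, hone, smul_zero, add_zero] at ht
      exact (mul_le_iff_le_one_left (norm_pos_iff.2 hfp)).1 ht
    have hneg : Tendsto (fun t : ℝ => -t) (𝓝 0) (𝓝 0) := by
      simpa using continuous_neg.tendsto (0 : ℝ)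
    obtain ⟨t, ⟨h1, h2⟩, ht⟩ := (((hle.and (hneg.eventually hle)).filter_mono
      (nhdsWithin_le_nhds (s := {0}ᶜ))).and self_mem_nhdsWithin).exists
    have hpar := parallelogram_law_with_norm ℝ (1 : ℍ[ℝ]) (t • w)
    rw [neg_smul, ← sub_eq_add_neg] at h2
    rw [norm_one] at hpar
    have h0 : ‖t • w‖ = 0 := by
      nlinarith [norm_nonneg (1 + t • w), norm_nonneg (1 - t • w), norm_nonneg (t • w)]
    exact (smul_eq_zero.1 (norm_eq_zero.1 h0)).resolve_left ht
  obtain ⟨g, hgc, hg, hga⟩ := exists_leftHolomorphicAt_stemOp_eq hI hstem hinj a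
  have hg1 : g z₀ = 1 := by
    refine sub_eq_zero.1 (hinj _ ?_)
    rw [map_sub, hga.self_of_nhds, hone, sub_self]
  have hmax : IsLocalMax (fun z => ‖g z‖) z₀ := by
    have hlim : Tendsto (fun z => (z, g z)) (𝓝 z₀) (𝓝 (z₀, 1)) := by
      have := continuousAt_id.prodMk hgc
      simpa [ContinuousAt, hg1] using this
    filter_upwards [hlim.eventually hbound, hga] with z h1 h2
    rw [h2] at h1
    rw [hg1, norm_one]
    exact (mul_le_iff_le_one_left (norm_pos_iff.2 hfp)).1 h1
  refine ⟨a, eq_const_of_eventually_sliceRestrict_eq hΩ hsymm hf hI hz₀ ?_⟩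
  -- With `g = 1`, the equation `A_z 1 = a` reads `b z + I * c z = a`, whose left side is `F z`.
  filter_upwards [LeftHolomorphicAt.eventually_eq_of_isLocalMax_norm hI hg hmax, hga] with z h1 h2
  rw [h1, hg1, stemOp_apply, one_mul, one_mul, stemRe_add_mul_stemIm hI] at h2
  exact h2
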